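/- Let $n$ be a cube-free positive integer, coprime to $3$, having exactly two distinct prime factors $\ell_1$ and $\ell_2$. Let $E_{-432n^2}$ be the elliptic curve $y^2=x^3-432n^2$ over $\mathbb{Q}$, and let $\operatorname{rk} E_{-432n^2}(\mathbb{Q})$ be its Mordell–Weil rank. Then $\operatorname{rk} E_{-432n^2}(\mathbb{Q})=0$, and $n$ is not a sum of two rational cubes, in each of the following cases: 1. $n=\ell_1\ell_2$ or $n=\ell_1^2\ell_2^2$, with $\ell_1\equiv 2 \pmod 9$ and $\ell_2\equiv 5\pmod 9$; 2. $n=\ell_1^2\ell_2$, with $\ell_1\equiv\ell_2\equiv 2\pmod 9$ or $\ell_1\equiv\ell_2\equiv 5\pmod 9$; 3. $n=\ell_1\ell_2$ or $n=\ell_1^2\ell_2$, with $n\equiv 2$ or $5\pmod 9$, where $\ell_1\equiv 1\pmod 3$, $\ell_2\equiv 2\pmod 3$ and $\ell_2$ is not a cube in $\mathbb{F}_{\ell_1}$; 4. $n=\ell_1^2\ell_2^2$ or $n=\ell_1\ell_2^2$, with $n\equiv 4$ or $7\pmod 9$, where $\ell_1\equiv 1\pmod 3$, $\ell_2\equiv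 2\pmod 3$ and $\ell_2$ is not a cube in $\mathbb{F}_{\ell_1}$. -/

import Mathlib

/-- The curve `y² = x³ + a` over `ℚ`, as a Weierstrass curve. -/
def mordellCurve (a : ℚ) : WeierstrassCurve.Affine ℚ :=
  { a₁ := 0, a₂ := 0, a₃ := 0, a₄ := 0, a₆ := a }

/-- The Mordell-Weil rank of a Weierstrass curve over `ℚ`: the rank, as a cardinal, of its group of
rational points as a `ℤ`-module. (As a cardinal it has no default value for infinite rank, so that
rank `0` really means that there is no point of infinite order.) -/
noncomputable def mordellWeilRank (W : WeierstrassCurve.Affine ℚ) : Cardinal :=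
  Module.rank ℤ W.Point

/-- `n` is cube-free: no cube of a prime divides it. -/
def CubeFree (n : ℕ) : Prop := ∀ p : ℕ, p.Prime → ¬ p ^ 3 ∣ n

/-- `n` is a sum of two rational cubes. -/
def IsRationalCubeSum (n : ℕ) : Prop := ∃ x y : ℚ, x ^ 3 + y ^ 3 = (n : ℚ)

/-- `a` is a cube in `𝔽_p = ℤ/pℤ`. -/
def IsCubeMod (a p : ℕ) : Prop := ∃ b : ZMod p, b ^ 3 = (a : ZMod p)

/-! The proof is an infinite descent on `x³ + y³ = n z³` in `ℤ[ω]`, where `n = pᵉ qᶠ` and `q` is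
inert. For coprime `x, y` the equation becomes `s * N(θ) = n * (cube)` with coprime factors: `s` is
`x + y` and `θ` a unit times `x + yω`, or, when `3 ∣ z`, `s = (x + y) / 9` and `θ = (x + yω) / (1 -
ω)`. The unit is chosen so that `θ` is a rational integer modulo `3`; this removes the unit
ambiguity when roots are extracted. As `q` is inert, `qᶠ ∣ s`.

If also `pᵉ ∣ s`, then `θ = α³` and `s = n a³`. The trace or the imaginary part of `α³` splits `s`
into three linear forms in `α` with sum zero. If `pᵉ` and `qᶠ` divide the same form, a smaller
solution results (`DescentData.exists_of_mul_eq`); otherwise `pᵉX³ + qᶠY³ + Z³ = 0`, which is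
impossible modulo `9` or modulo `p`.

If `pᵉ ∣ N(θ)`, then `p ≡ 1 mod 3` and, up to conjugation, `θ = πᵉ α³`. With `π` a cubic Jacobi sum,
the conjugate of `π` is a cube modulo `π` (`exists_norm_eq_prime`), so reducing the relation between
`s` and `θ` makes `q` a cube modulo `p`, contrary to hypothesis.

One residue class, `3 ∤ (x + y)(x - y)`, escapes this. It forces `n ≡ ±1 mod 9`, hence `p ≡ 2, 5 mod
9`, and then `not_dvd_cube_re_add_im` excludes it.

Finally, an affine point of the curve would make `n` a sum of two cubes, so the group of points is
trivial. -/

/-- The ring `ℤ[ω]` of Eisenstein integers, `ω² = -1 - ω`. -/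
abbrev Eisenstein : Type := QuadraticAlgebra ℤ (-1) (-1)

/-! ### Arithmetic of `ℤ[ω]`: Euclidean division, units and extraction of cube roots -/

namespace Eisenstein

open QuadraticAlgebra

lemma norm_eq (z : Eisenstein) : z.norm = z.re ^ 2 - z.re * z.im + z.im ^ 2 := by
  rw [norm_def]; ring

lemma norm_nonneg (z : Eisenstein) : 0 ≤ z.norm := by
  rw [norm_eq]; nlinarith [sq_nonneg (2 * z.re - z.im), sq_nonneg z.im]

lemma norm_eq_zero {z : Eisenstein} : z.norm = 0 ↔ z = 0 := by
  refine ⟨fun h ↦ ?_, fun h ↦ by simp [h]⟩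
  rw [norm_eq] at h
  have h2 : z.im = 0 := by
    have : z.im ^ 2 ≤ 0 := by nlinarith [sq_nonneg (2 * z.re - z.im)]
    exact pow_eq_zero_iff two_ne_zero |>.1 (le_antisymm this (sq_nonneg _))
  have h1 : z.re = 0 := by simpa [h2] using h
  ext <;> simp [h1, h2]

lemma norm_pos {z : Eisenstein} (hz : z ≠ 0) : 0 < z.norm :=
  lt_of_le_of_ne (norm_nonneg z) fun h ↦ hz (norm_eq_zero.1 h.symm)

lemma intCast_norm (z : Eisenstein) : ((z.norm : ℤ) : Eisenstein) = z * star z := by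
  rw [← algebraMap_norm_eq_mul_star]; rfl

/-- Division with rounding to a nearest Eisenstein integer. -/
def quot (x y : Eisenstein) : Eisenstein :=
  ⟨(2 * (x * star y).re + y.norm) / (2 * y.norm), (2 * (x * star y).im + y.norm) / (2 * y.norm)⟩

/-- Rounding leaves an error of at most `1/2` in each coordinate, and there `r² - rs + s² ≤ 3/4`. -/
lemma norm_sub_mul_quot_lt (x : Eisenstein) {y : Eisenstein} (hy : y ≠ 0) :
    (x - y * quot x y).norm < y.norm := by
  have hn := norm_pos hy
  have key : star y * (x - y * quot x y) = x * star y - (y.norm : ℤ) * quot x y := by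
    rw [intCast_norm]; ring
  have hN : y.norm * (x - y * quot x y).norm =
      (x * star y - (y.norm : ℤ) * quot x y).norm := by
    rw [← key, map_mul, QuadraticAlgebra.norm_star]
  set c := x * star y with hc
  set n := y.norm with hn'
  set r := c.re - n * (quot x y).re with hr
  set s := c.im - n * (quot x y).im with hs
  have e : (c - (n : ℤ) * quot x y).norm = r ^ 2 - r * s + s ^ 2 := by
    rw [norm_eq]; simp [hr, hs]
  have b (t : ℤ) : -n ≤ 2 * (t - n * ((2 * t + n) / (2 * n))) ∧
      2 * (t - n * ((2 * t + n) / (2 * n))) ≤ n := by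
    have h1 := Int.mul_ediv_add_emod (2 * t + n) (2 * n)
    have h2 := Int.emod_nonneg (2 * t + n) (by positivity : 2 * n ≠ 0)
    have h3 := Int.emod_lt_of_pos (2 * t + n) (by positivity : 0 < 2 * n)
    constructor <;> nlinarith
  obtain ⟨r1, r2⟩ : -n ≤ 2 * r ∧ 2 * r ≤ n := b c.re
  obtain ⟨s1, s2⟩ : -n ≤ 2 * s ∧ 2 * s ≤ n := b c.im
  rw [e] at hN
  have hr4 : 4 * r ^ 2 ≤ n ^ 2 := by nlinarith
  have hs4 : 4 * s ^ 2 ≤ n ^ 2 := by nlinarith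
  have : 8 * (r ^ 2 - r * s + s ^ 2) ≤ 6 * n ^ 2 := by
    nlinarith [sq_nonneg (r + s)]
  by_contra! hle
  nlinarith [mul_le_mul_of_nonneg_left hle hn.le]

noncomputable instance : EuclideanDomain Eisenstein where
  __ := (inferInstance : CommRing Eisenstein)
  __ := (inferInstance : Nontrivial Eisenstein)
  quotient := quot
  remainder x y := x - y * quot x y
  quotient_zero x := by ext <;> simp [quot]
  quotient_mul_add_remainder_eq x y := by ring
  r x y := x.norm.natAbs < y.norm.natAbs
  r_wellFounded := (measure (fun z : Eisenstein ↦ z.norm.natAbs)).wf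
  remainder_lt x {y} hy := by
    have h1 := norm_sub_mul_quot_lt x hy
    have h2 := norm_nonneg (x - y * quot x y)
    show (x - y * quot x y).norm.natAbs < y.norm.natAbs
    omega
  mul_left_not_lt x {y} hy := by
    have h1 := norm_pos hy
    have h2 := norm_nonneg x
    have h3 : x.norm ≤ x.norm * y.norm := by nlinarith
    rw [map_mul]
    omega

lemma norm_of_isUnit {u : Eisenstein} (hu : IsUnit u) : u.norm = 1 := by
  have h := isUnit_iff_norm_isUnit.1 hu
  have := norm_nonneg u
  rcases Int.isUnit_iff.1 h with h | h <;> omega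

lemma eq_one_or_neg_one_of_isUnit {u : Eisenstein} (hu : IsUnit u) (h3 : 3 ∣ u.im) :
    u = 1 ∨ u = -1 := by
  have h := norm_of_isUnit hu
  obtain ⟨k, hk⟩ := h3
  rw [norm_eq, hk] at h
  have hk0 : k = 0 := by
    have : k ^ 2 < 1 := by nlinarith [sq_nonneg (2 * u.re - 3 * k)]
    exact pow_eq_zero_iff two_ne_zero |>.1 (le_antisymm (by omega) (sq_nonneg k))
  subst hk0
  have : u.re = 1 ∨ u.re = -1 := sq_eq_one_iff.1 (by linarith)
  rcases this with h | h
  · left; ext <;> simp [h, hk]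
  · right; ext <;> simp [h, hk]

lemma three_dvd_im_mul {z w : Eisenstein} (hz : 3 ∣ z.im) (hw : 3 ∣ w.im) : 3 ∣ (z * w).im := by
  rw [im_mul]
  exact dvd_add (dvd_add (hw.mul_left _) (hz.mul_right _)) (hw.mul_left _)

lemma three_dvd_im_pow {z : Eisenstein} (hz : 3 ∣ z.im) (e : ℕ) : 3 ∣ (z ^ e).im := by
  induction e with
  | zero => simp
  | succ e ih => rw [pow_succ]; exact three_dvd_im_mul ih hz

lemma cube_im (z : Eisenstein) : (z ^ 3).im = 3 * (z.re * z.im * (z.re - z.im)) := by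
  simp [pow_succ]; ring

lemma cube_re (z : Eisenstein) : (z ^ 3).re = z.re ^ 3 + z.im ^ 3 - 3 * z.re * z.im ^ 2 := by
  simp [pow_succ]; ring

/-- If `θ` and `w` are congruent to rational integers modulo `3`, and prime to `3`, then so is
the unit `u` with `θ = w * u`, which is therefore a sign. -/
lemma unit_eq_one_or_neg_one {θ w u : Eisenstein} (hu : IsUnit u) (h : w * u = θ)
    (hθ : 3 ∣ θ.im) (hw : 3 ∣ w.im) (hN : IsCoprime 3 θ.norm) : u = 1 ∨ u = -1 := by
  refine eq_one_or_neg_one_of_isUnit hu ?_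
  -- Multiplying by `star w` isolates `u` up to the integer `N(w)`, which is prime to `3`.
  have h1 : star w * θ = (w.norm : ℤ) * u := by rw [← h, intCast_norm]; ring
  have h2 : 3 ∣ (star w * θ).im := three_dvd_im_mul (by simpa using hw) hθ
  rw [h1] at h2
  have h3 : θ.norm = w.norm := by rw [← h, map_mul, norm_of_isUnit hu, mul_one]
  rw [h3] at hN
  refine hN.dvd_of_dvd_mul_left ?_
  simpa using h2

/-- The ideal `(θ, star θ)` contains `re * √-3` and `im * √-3`, hence `√-3`, and also the norm,
which is prime to `3`. -/
lemma isCoprime_star {θ : Eisenstein} (h : IsCoprime θ.re θ.im) (hN : IsCoprime 3 θ.norm) :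
    IsCoprime θ (star θ) := by
  obtain ⟨a, b, hab⟩ := h
  obtain ⟨c, d, hcd⟩ := hN
  set δ : Eisenstein := ⟨1, 2⟩ with hδ
  have h1 : θ - star θ = (θ.im : ℤ) * δ := by ext <;> simp [hδ]; ring
  set ρ : Eisenstein := ⟨0, 1⟩ with hρ
  have h2 : star ρ * θ - ρ * star θ = - ((θ.re : ℤ) * δ) := by ext <;> simp [hδ, hρ]; ring
  have h3 : δ * δ = -3 := by ext <;> simp [hδ]
  have h4 := intCast_norm θ
  have h5 : (a : Eisenstein) * θ.re + b * θ.im = 1 := by exact_mod_cast congrArg (Int.cast) hab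
  have h6 : (c : Eisenstein) * 3 + d * θ.norm = 1 := by exact_mod_cast congrArg (Int.cast) hcd
  refine ⟨-c * δ * (-a * star ρ + b) + d * star θ, -c * δ * (a * ρ - b), ?_⟩
  linear_combination h6 + (-c * δ * b) * h1 + (c * δ * a) * h2 + (-c * (b * θ.im + a * θ.re)) * h3
    - d * h4 + 3 * c * h5

/-- A primitive Eisenstein integer of cube norm, prime to `3` and congruent to a rational integer
modulo `3`, is a cube. -/
lemma exists_eq_cube {θ : Eisenstein} {b : ℤ} (h : IsCoprime θ.re θ.im) (hb : θ.norm = b ^ 3)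
    (h3 : IsCoprime 3 θ.norm) (hθ : 3 ∣ θ.im) : ∃ α : Eisenstein, θ = α ^ 3 := by
  have h1 : θ * star θ = (b : Eisenstein) ^ 3 := by rw [← intCast_norm, hb]; push_cast; rfl
  obtain ⟨α, u, hu⟩ := exists_associated_pow_of_mul_eq_pow' (isCoprime_star h h3) h1
  rcases unit_eq_one_or_neg_one u.isUnit hu hθ (by rw [cube_im]; exact dvd_mul_right _ _) h3
    with h | h
  · exact ⟨α, by rw [← hu, h, mul_one]⟩
  · exact ⟨-α, by rw [← hu, h]; ring⟩

lemma prime_of_norm_eq_prime {z : Eisenstein} {p : ℕ} (hp : p.Prime) (h : z.norm = p) :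
    Prime z := by
  rw [← irreducible_iff_prime]
  refine ⟨fun hu ↦ ?_, fun a b hab ↦ ?_⟩
  · have := norm_of_isUnit hu
    rw [this] at h
    exact hp.one_lt.ne (by exact_mod_cast h)
  · rw [hab, map_mul] at h
    have hp' : Irreducible (p : ℤ) := (Nat.prime_iff_prime_int.1 hp).irreducible
    exact (hp'.isUnit_or_isUnit h.symm).imp isUnit_iff_norm_isUnit.2 isUnit_iff_norm_isUnit.2

/-- A primitive Eisenstein integer of norm `p ^ e` times a cube, prime to `3` and congruent to a
rational integer modulo `3`, is `π ^ e` times a cube, for the suitable divisor `π` of `p`. -/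
lemma exists_eq_pow_mul_cube_of_dvd {θ π : Eisenstein} {p e : ℕ} {b : ℤ} (hp : p.Prime)
    (h : IsCoprime θ.re θ.im) (hb : θ.norm = p ^ e * b ^ 3)
    (h3 : IsCoprime 3 θ.norm) (hθ : 3 ∣ θ.im) (hπ : π.norm = p) (hπ3 : 3 ∣ π.im) (hd : π ∣ θ) :
    ∃ α : Eisenstein, θ = π ^ e * α ^ 3 := by
  have hpr := prime_of_norm_eq_prime hp hπ
  have hco := isCoprime_star h h3
  have hpθ : IsCoprime (π ^ e) (star θ) := (hco.of_isCoprime_of_dvd_left hd).pow_left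
  have h1 : θ * star θ = π ^ e * (star π) ^ e * (b : Eisenstein) ^ 3 := by
    rw [← mul_pow, ← intCast_norm, ← intCast_norm, hb, hπ]; push_cast; rfl
  obtain ⟨η, hη⟩ : π ^ e ∣ θ := hpθ.dvd_of_dvd_mul_right ⟨_, by rw [h1, mul_assoc]⟩
  have h2 : star θ = (star π) ^ e * star η := by rw [hη, star_mul, star_pow]; ring
  have hp0 : π ^ e ≠ 0 := pow_ne_zero _ hpr.ne_zero
  have hq0 : (star π) ^ e ≠ 0 := pow_ne_zero _ fun h ↦ hpr.ne_zero (star_eq_zero.1 h)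
  have h4 : η * star η = (b : Eisenstein) ^ 3 := by
    apply mul_left_cancel₀ (mul_ne_zero hp0 hq0)
    rw [← h1, h2, hη]; ring
  have hco' : IsCoprime η (star η) :=
    (hco.of_isCoprime_of_dvd_left ⟨_, by rw [hη, mul_comm]⟩).of_isCoprime_of_dvd_right
      ⟨_, by rw [h2, mul_comm]⟩
  obtain ⟨α, u, hu⟩ := exists_associated_pow_of_mul_eq_pow' hco' h4
  have hu' : π ^ e * α ^ 3 * u = θ := by rw [hη, ← hu, mul_assoc]
  rcases unit_eq_one_or_neg_one u.isUnit hu' hθ (three_dvd_im_mul (three_dvd_im_pow hπ3 e)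
    (by rw [cube_im]; exact dvd_mul_right _ _)) h3 with h | h
  · exact ⟨α, by rw [← hu', h, mul_one]⟩
  · exact ⟨-α, by rw [← hu', h]; ring⟩

lemma exists_eq_pow_mul_cube {θ π : Eisenstein} {p e : ℕ} {b : ℤ} (hp : p.Prime) (he : e ≠ 0)
    (h : IsCoprime θ.re θ.im) (hb : θ.norm = p ^ e * b ^ 3)
    (h3 : IsCoprime 3 θ.norm) (hθ : 3 ∣ θ.im) (hπ : π.norm = p) (hπ3 : 3 ∣ π.im) :
    (∃ α : Eisenstein, θ = π ^ e * α ^ 3) ∨ ∃ α : Eisenstein, star θ = π ^ e * α ^ 3 := by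
  have hpr := prime_of_norm_eq_prime hp hπ
  have hd : π ∣ θ * star θ := by
    rw [← intCast_norm, hb]
    have : π ∣ (p : Eisenstein) := ⟨star π, by rw [← intCast_norm, hπ]; rfl⟩
    push_cast
    exact (this.trans (dvd_pow_self _ he)).mul_right _
  rcases hpr.dvd_or_dvd hd with hd | hd
  · exact .inl (exists_eq_pow_mul_cube_of_dvd hp h hb h3 hθ hπ hπ3 hd)
  · refine .inr (exists_eq_pow_mul_cube_of_dvd hp (b := b) ?_ ?_ ?_ ?_ hπ hπ3 hd)
    · obtain ⟨c, d, hcd⟩ := h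
      exact ⟨c, -(c + d), by simp; linarith⟩
    · rw [QuadraticAlgebra.norm_star, hb]
    · rwa [QuadraticAlgebra.norm_star]
    · simpa using hθ

end Eisenstein

/-! ### Cube roots of unity and homomorphisms out of `ℤ[ω]` -/

namespace Eisenstein

open QuadraticAlgebra

lemma isPrimitiveRoot_omega : IsPrimitiveRoot (⟨0, 1⟩ : Eisenstein) 3 := by
  rw [IsPrimitiveRoot.iff (by norm_num)]
  refine ⟨by ext <;> simp [pow_succ], fun l h0 h3 h ↦ ?_⟩
  interval_cases l
  · simpa using congrArg im h
  · simpa [pow_succ] using congrArg im h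

/-- The ring homomorphism from the Eisenstein integers that sends `ω` to `w`. -/
noncomputable def evalHom {A : Type*} [CommRing A] (w : A) (hw : w ^ 2 + w + 1 = 0) :
    Eisenstein →+* A :=
  (QuadraticAlgebra.lift (R := ℤ) (a := -1) (b := -1)
    ⟨w, by simp; linear_combination hw⟩ : Eisenstein →ₐ[ℤ] A).toRingHom

lemma evalHom_mk {A : Type*} [CommRing A] (w : A) (hw : w ^ 2 + w + 1 = 0) (x y : ℤ) :
    evalHom w hw ⟨x, y⟩ = x + y * w := by
  simp [evalHom, QuadraticAlgebra.lift]

end Eisenstein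

/-! ### Power sums and the central binomial coefficient modulo `p = 3k + 1` -/

namespace ZMod

open Finset

variable {p k : ℕ} [Fact p.Prime]

lemma sum_pow_mul_one_sub_pow_eq_zero (hp : p = 3 * k + 1) :
    ∑ x : ZMod p, x ^ k * (1 - x) ^ k = 0 := by
  have hk : 0 < k := by
    have := (Fact.out : p.Prime).one_lt
    omega
  have h (x : ZMod p) : x ^ k * (1 - x) ^ k =
      ∑ j ∈ range (k + 1), (-1) ^ j * (k.choose j : ZMod p) * x ^ (k + j) := by
    rw [sub_eq_neg_add, add_pow, mul_sum]
    refine sum_congr rfl fun j _ ↦ ?_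
    rw [neg_pow, one_pow, pow_add]; ring
  simp_rw [h]
  rw [sum_comm]
  refine sum_eq_zero fun j hj ↦ ?_
  rw [mem_range] at hj
  rw [← mul_sum, FiniteField.sum_pow_lt_card_sub_one, mul_zero]
  rw [ZMod.card]; omega

/-- The exponents in the expansion run from `2k` to `4k`, and only `3k = p - 1` contributes to a sum
over all residues. -/
lemma sum_pow_mul_one_sub_pow_two_mul (hp : p = 3 * k + 1) :
    ∑ x : ZMod p, x ^ (2 * k) * (1 - x) ^ (2 * k) = - ((-1) ^ k * ((2 * k).choose k : ZMod p)) := by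
  have hk : 0 < k := by
    have := (Fact.out : p.Prime).one_lt
    omega
  have h (x : ZMod p) : x ^ (2 * k) * (1 - x) ^ (2 * k) =
      ∑ j ∈ range (2 * k + 1), (-1) ^ j * ((2 * k).choose j : ZMod p) * x ^ (2 * k + j) := by
    rw [sub_eq_neg_add, add_pow, mul_sum]
    refine sum_congr rfl fun j _ ↦ ?_
    rw [neg_pow, one_pow, pow_add]; ring
  simp_rw [h]
  rw [sum_comm, sum_eq_single_of_mem k (by rw [mem_range]; omega)]
  · have h1 : ∑ x : ZMod p, x ^ (2 * k + k) = -1 := by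
      have h2 (x : ZMod p) : x ^ (2 * k + k) = 1 - if x = 0 then 1 else 0 := by
        split_ifs with h0
        · rw [h0, zero_pow (by omega)]; ring
        · rw [show 2 * k + k = p - 1 by omega, ZMod.pow_card_sub_one_eq_one h0, sub_zero]
      simp_rw [h2]
      simp
    rw [← mul_sum, h1]; ring
  · intro j hj hjk
    rw [mem_range] at hj
    rw [← mul_sum]
    rcases lt_or_gt_of_ne hjk with hlt | hgt
    · rw [FiniteField.sum_pow_lt_card_sub_one, mul_zero]
      rw [ZMod.card]; omega
    · have h3 (x : ZMod p) : x ^ (2 * k + j) = x ^ (j - k) := by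
        rw [show 2 * k + j = p + (j - k - 1) by omega, pow_add, ZMod.pow_card, ← pow_succ']
        congr 1; omega
      simp_rw [h3]
      rw [FiniteField.sum_pow_lt_card_sub_one, mul_zero]
      rw [ZMod.card]; omega

/-- For a prime `p = 3k + 1`, the central binomial coefficient is a cube modulo `p`. -/
lemma exists_neg_choose_eq_cube (hp : p = 3 * k + 1) :
    ∃ c : ZMod p, - ((-1) ^ k * ((2 * k).choose k : ZMod p)) = c ^ 3 := by
  have hpp := (Fact.out : p.Prime)
  have hk0 : (k.factorial : ZMod p) ≠ 0 := by
    rw [Ne, ZMod.natCast_eq_zero_iff, hpp.dvd_factorial]; omega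
  have h1 : ((2 * k).choose k : ZMod p) * k.factorial * k.factorial = (2 * k).factorial := by
    have := Nat.choose_mul_factorial_mul_factorial (show k ≤ 2 * k by omega)
    rw [show 2 * k - k = k by omega] at this
    exact_mod_cast congrArg (Nat.cast (R := ZMod p)) this
  -- The product does not depend on `m`, since `k - m ≡ -(2k + m + 1)` modulo `p`. At `m = k`,
  -- Wilson's theorem gives `(2k)! k! = ±1`.
  have h2 : ∀ m, m ≤ k →
      ((2 * k + m).factorial : ZMod p) * (k - m).factorial * (-1) ^ m =
        (2 * k).factorial * k.factorial := by
    intro m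
    induction m with
    | zero => simp
    | succ m ih =>
      intro hm
      rw [← ih (by omega)]
      have e : k - m = (k - (m + 1)) + 1 := by omega
      have e2 : ((k - (m + 1) : ℕ) : ZMod p) + 1 = -(2 * k + m + 1) := by
        have : ((k - (m + 1) + 1 + (2 * k + m + 1) : ℕ) : ZMod p) = 0 := by
          rw [show k - (m + 1) + 1 + (2 * k + m + 1) = p by omega, ZMod.natCast_self]
        push_cast at this
        linear_combination this
      rw [e, Nat.factorial_succ, ← add_assoc, Nat.factorial_succ]
      push_cast
      rw [e2]; ring
  have h3 := h2 k le_rfl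
  have h4 : ((2 * k + k).factorial : ZMod p) = -1 := by
    rw [show 2 * k + k = p - 1 by omega]; exact ZMod.wilsons_lemma p
  rw [h4] at h3
  simp only [tsub_self, Nat.factorial_zero, Nat.cast_one, mul_one] at h3
  have hs : ((-1 : ZMod p) ^ k) ^ 2 = 1 := by rw [← pow_mul, mul_comm, pow_mul]; simp
  refine ⟨(k.factorial : ZMod p)⁻¹, ?_⟩
  field_simp
  linear_combination ((-1) ^ k * k.factorial * (-1)) * h1 + (-1) ^ k * h3 + hs

end ZMod

/-! ### The cubic Jacobi sum as a prime above `p` -/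

namespace Eisenstein

open QuadraticAlgebra Finset

/-- A prime `p ≡ 1 [MOD 3]` is the norm of an Eisenstein integer `π` that is congruent to a rational
integer modulo `3`, and the conjugate of `π` is a cube modulo `π`. -/
theorem exists_norm_eq_prime {p : ℕ} [Fact p.Prime] (hp : p ≡ 1 [MOD 3]) :
    ∃ (π : Eisenstein) (φ : Eisenstein →+* ZMod p) (c : ZMod p),
      π.norm = p ∧ 3 ∣ π.im ∧ φ π = 0 ∧ φ (star π) = c ^ 3 := by
  have hpp := (Fact.out : p.Prime)
  obtain ⟨k, hk⟩ : ∃ k, p = 3 * k + 1 := ⟨p / 3, by rw [Nat.ModEq] at hp; omega⟩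
  have hk0 : 0 < k := by have := hpp.one_lt; omega
  obtain ⟨g, hg⟩ := IsCyclic.exists_generator (α := (ZMod p)ˣ)
  have hord : orderOf g = 3 * k := by
    rw [orderOf_eq_card_of_forall_mem_zpowers hg, Nat.card_eq_fintype_card,
      ZMod.card_units_eq_totient, Nat.totient_prime hpp, hk]; rfl
  set w : ZMod p := (g : ZMod p) ^ k with hw
  have hw1 : w ≠ 1 := by
    intro h
    have : g ^ k = 1 := by ext; simpa [hw] using h
    have := orderOf_dvd_of_pow_eq_one this
    rw [hord] at this
    have := Nat.le_of_dvd hk0 this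
    omega
  have hw3 : w ^ 3 = 1 := by
    rw [hw, ← pow_mul, mul_comm, ← hord, ← Units.val_pow_eq_pow_val, pow_orderOf_eq_one]; rfl
  have hw2 : w ^ 2 + w + 1 = 0 := by
    apply mul_left_cancel₀ (sub_ne_zero.2 hw1)
    linear_combination hw3
  set φ := evalHom w hw2 with hφ
  set ζ : Eisenstein := ⟨0, 1⟩ with hζ
  have hζr : IsPrimitiveRoot ζ 3 := isPrimitiveRoot_omega
  have hcard : Fintype.card (ZMod p)ˣ = 3 * k := by
    rw [ZMod.card_units_eq_totient, Nat.totient_prime hpp, hk]; rfl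
  set u : Eisensteinˣ := (hζr.isUnit (by norm_num)).unit with hu
  have hu1 : (u : Eisenstein) = ζ := rfl
  have humem : u ∈ rootsOfUnity (Fintype.card (ZMod p)ˣ) Eisenstein := by
    rw [mem_rootsOfUnity, hcard, pow_mul]
    have : u ^ 3 = 1 := by ext1; rw [Units.val_pow_eq_pow_val, hu1, hζr.pow_eq_one]; rfl
    rw [this, one_pow]
  set χ := MulChar.ofRootOfUnity humem hg with hχ
  have hχg : χ g = ζ := MulChar.ofRootOfUnity_spec humem hg
  have hφζ : φ ζ = w := by rw [hφ, hζ, evalHom_mk]; simp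
  have hunit (x : ZMod p) (hx : x ≠ 0) : ∃ j : ℕ, x = (g : ZMod p) ^ j := by
    obtain ⟨j, hj⟩ := (mem_powers_iff_mem_zpowers.2 (hg (Units.mk0 x hx)))
    exact ⟨j, by simpa using (congrArg Units.val hj).symm⟩
  -- Modulo the prime `ker φ` the cubic character is `x ↦ x ^ k`, so Jacobi sums reduce to the power
  -- sums above.
  have hφχ (x : ZMod p) : φ (χ x) = x ^ k := by
    by_cases hx : x = 0
    · rw [hx, MulChar.map_zero, map_zero, zero_pow hk0.ne']
    · obtain ⟨j, rfl⟩ := hunit x hx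
      rw [map_pow, map_pow, hχg, hφζ, hw, ← pow_mul, ← pow_mul, mul_comm]
  have hχ3 (x : ZMod p) (hx : x ≠ 0) : χ x ^ 3 = 1 := by
    obtain ⟨j, rfl⟩ := hunit x hx
    rw [map_pow, hχg, ← pow_mul, mul_comm, pow_mul, hζr.pow_eq_one, one_pow]
  have hstar (x : ZMod p) : star (χ x) = χ x ^ 2 := by
    by_cases hx : x = 0
    · rw [hx, MulChar.map_zero, star_zero]; ring
    · obtain ⟨j, rfl⟩ := hunit x hx
      have : star ζ = ζ ^ 2 := by ext <;> simp [hζ, pow_succ]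
      rw [map_pow, hχg, star_pow, this, ← pow_mul, ← pow_mul, mul_comm]
  have hinv (x : ZMod p) : χ⁻¹ x = star (χ x) := by
    by_cases hx : x = 0
    · rw [hx, MulChar.map_zero, MulChar.map_zero, star_zero]
    · have h1 : χ⁻¹ x * χ x = 1 := by
        rw [← MulChar.mul_apply, inv_mul_cancel, MulChar.one_apply (isUnit_iff_ne_zero.2 hx)]
      rw [hstar]
      linear_combination χ x ^ 2 * h1 - χ⁻¹ x * hχ3 x hx
  have hχ1 : χ ^ 3 = 1 := by
    refine MulChar.ext fun x ↦ ?_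
    rw [MulChar.pow_apply_coe, hχ3 _ x.ne_zero, MulChar.one_apply_coe]
  have hne : χ ≠ 1 := by
    intro h
    rw [h, MulChar.one_apply_coe] at hχg
    exact hζr.ne_one (by norm_num) hχg.symm
  have hne2 : χ * χ ≠ 1 := by
    intro h
    have : χ ^ 3 = χ := by rw [pow_succ, pow_two, h, one_mul]
    exact hne (this.symm.trans hχ1)
  set J := jacobiSum χ χ with hJ
  have hJstar : star J = jacobiSum χ⁻¹ χ⁻¹ := by
    simp only [hJ, jacobiSum, star_sum, star_mul, hinv]
    exact sum_congr rfl fun _ _ ↦ mul_comm _ _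
  refine ⟨J, φ, ?_⟩
  obtain ⟨c, hc⟩ := ZMod.exists_neg_choose_eq_cube hk
  refine ⟨c, ?_, ?_, ?_, ?_⟩
  -- The product formula for Jacobi sums is applied over a field, then pulled back along the
  -- injection.
  · let F := FractionRing Eisenstein
    let ι := algebraMap Eisenstein F
    have hι : Function.Injective ι := IsFractionRing.injective Eisenstein F
    have hchar : ringChar F ≠ ringChar (ZMod p) := by
      have : CharZero Eisenstein := ⟨fun a b h ↦ by simpa using congrArg re h⟩
      have : CharZero F := charZero_of_injective_algebraMap hι
      rw [ringChar.eq_zero, ZMod.ringChar_zmod_n]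
      exact hpp.ne_zero.symm
    have h := jacobiSum_mul_jacobiSum_inv (F := ZMod p) (F' := F) hchar
      ((MulChar.ringHomComp_ne_one_iff hι).2 hne) ((MulChar.ringHomComp_ne_one_iff hι).2 hne)
      (by rw [← MulChar.ringHomComp_mul]; exact (MulChar.ringHomComp_ne_one_iff hι).2 hne2)
    rw [MulChar.ringHomComp_inv, jacobiSum_ringHomComp, jacobiSum_ringHomComp, ← map_mul,
      ← hJstar, ← intCast_norm, ZMod.card, ← map_natCast ι] at h
    simpa using congrArg re (hι h)
  -- `J = -1 + z (ω - 1)²` and `(ω - 1)² = -3ω`.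
  · obtain ⟨z, -, hz⟩ := exists_jacobiSum_eq_neg_one_add (F := ZMod p) (n := 3) (by norm_num)
      hχ1 hχ1 (by rw [ZMod.card, hk]; exact ⟨k, rfl⟩) hζr
    rw [← hJ] at hz
    refine ⟨z.im - z.re, ?_⟩
    rw [hz]
    simp [hζ, pow_succ]; ring
  · simp only [hJ, jacobiSum, map_sum, map_mul, hφχ]
    exact ZMod.sum_pow_mul_one_sub_pow_eq_zero hk
  · rw [← hc, ← ZMod.sum_pow_mul_one_sub_pow_two_mul hk, hJstar]
    simp only [jacobiSum, hinv, hstar, map_sum, map_mul, map_pow, hφχ]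
    refine sum_congr rfl fun x _ ↦ ?_
    rw [← pow_mul, ← pow_mul, mul_comm k 2]

end Eisenstein

/-! ### Inert primes -/

namespace Eisenstein

open QuadraticAlgebra

/-- A prime `p ≡ 2 [MOD 3]` is inert in the Eisenstein integers. -/
lemma dvd_of_dvd_norm {p : ℕ} (hp : p.Prime) (hp2 : p ≡ 2 [MOD 3]) {z : Eisenstein}
    (h : (p : ℤ) ∣ z.norm) : (p : ℤ) ∣ z.re ∧ (p : ℤ) ∣ z.im := by
  have : Fact p.Prime := ⟨hp⟩
  obtain ⟨k, hk⟩ : ∃ k, p = 3 * k + 2 := ⟨p / 3, by rw [Nat.ModEq] at hp2; omega⟩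
  simp only [← ZMod.intCast_zmod_eq_zero_iff_dvd] at h ⊢
  rw [norm_eq] at h
  push_cast at h
  set u : ZMod p := Int.cast z.re
  set v : ZMod p := Int.cast z.im
  -- Cubing is invertible because `3 (2k + 1) = 2 (p - 1) + 1`; so `u³ = (-v)³` gives `u = -v`.
  have hpow (t : ZMod p) : (t ^ 3) ^ (2 * k + 1) = t := by
    by_cases ht : t = 0
    · rw [ht]; simp
    · rw [← pow_mul, show 3 * (2 * k + 1) = (p - 1) * 2 + 1 by omega, pow_succ, pow_mul,
        ZMod.pow_card_sub_one_eq_one ht, one_pow, one_mul]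
  have h1 : u ^ 3 = (-v) ^ 3 := by linear_combination (u + v) * h
  have huv : u = -v := by rw [← hpow u, h1, hpow]
  have h3 : (3 : ZMod p) ≠ 0 := by
    intro h0
    have : ((3 : ℕ) : ZMod p) = 0 := by exact_mod_cast h0
    rw [ZMod.natCast_eq_zero_iff, Nat.prime_dvd_prime_iff_eq hp Nat.prime_three] at this
    omega
  have hv : v = 0 := by
    have : 3 * v ^ 2 = 0 := by rw [← h, huv]; ring
    simpa [h3] using this
  exact ⟨by rw [huv, hv, neg_zero], hv⟩

/-- The Eisenstein integers modulo `p`. -/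
abbrev EisensteinMod (p : ℕ) : Type := QuadraticAlgebra (ZMod p) (-1) (-1)

/-- A prime `p ≡ 2, 5 [MOD 9]` does not divide a primitive value of the cubic form
`u³ + 3u²v - 6uv² + v³`. -/
lemma not_dvd_cube_re_add_im {p : ℕ} (hp : p.Prime) (hp9 : p ≡ 2 [MOD 9] ∨ p ≡ 5 [MOD 9])
    {z : Eisenstein} (hz : IsCoprime z.re z.im) : ¬ (p : ℤ) ∣ (z ^ 3).re + (z ^ 3).im := by
  have : Fact p.Prime := ⟨hp⟩
  intro h
  have hp3 : p ≡ 2 [MOD 3] := by simp only [Nat.ModEq] at hp9 ⊢; omega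
  have : CharP (EisensteinMod p) p := charP_of_injective_algebraMap
    (algebraMap_injective (R := ZMod p) (a := -1) (b := -1)) p
  set u : ZMod p := Int.cast z.re with hu
  set v : ZMod p := Int.cast z.im with hv
  have hN : u ^ 2 - u * v + v ^ 2 ≠ 0 := by
    intro h0
    have h0' : ((z.norm : ℤ) : ZMod p) = 0 := by rw [norm_eq]; push_cast; exact h0
    rw [ZMod.intCast_zmod_eq_zero_iff_dvd] at h0'
    obtain ⟨h1, h2⟩ := dvd_of_dvd_norm hp hp3 h0'
    exact (Nat.prime_iff_prime_int.1 hp).not_isUnit (hz.isUnit_of_dvd' h1 h2)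
  have hf : u ^ 3 + 3 * u ^ 2 * v - 6 * u * v ^ 2 + v ^ 3 = 0 := by
    rw [← ZMod.intCast_zmod_eq_zero_iff_dvd, cube_re, cube_im] at h
    push_cast at h
    linear_combination h
  set α : EisensteinMod p := ⟨u, v⟩ with hα
  set ᾱ : EisensteinMod p := ⟨u - v, -v⟩ with hᾱ
  set ζ : EisensteinMod p := ⟨0, 1⟩ with hζ
  have hζ3 : ζ ^ 3 = 1 := by ext <;> simp [hζ, pow_succ]
  have hζk (k : ℕ) : ζ ^ (3 * k) = 1 := by rw [pow_mul, hζ3, one_pow]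
  have hα' : α = algebraMap (ZMod p) (EisensteinMod p) u +
      algebraMap (ZMod p) (EisensteinMod p) v * ζ := by
    ext <;> simp [hα, hζ]
  have hᾱ' : ᾱ = algebraMap (ZMod p) (EisensteinMod p) u +
      algebraMap (ZMod p) (EisensteinMod p) v * ζ ^ 2 := by
    ext <;> simp [hᾱ, hζ, pow_succ]; ring
  obtain ⟨k, hk⟩ : ∃ k, p = 3 * k + 2 := ⟨p / 3, by rw [Nat.ModEq] at hp3; omega⟩
  -- Frobenius is conjugation, as `p ≡ 2 mod 3`.
  have hfrob : α ^ p = ᾱ := by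
    rw [hα', add_pow_char, mul_pow, ← map_pow, ← map_pow, ZMod.pow_card, ZMod.pow_card, hᾱ']
    have : ζ ^ p = ζ ^ (3 * k + 2) := congrArg _ hk
    rw [this, pow_add, hζk, one_mul]
  have hfrob' : ᾱ ^ p = α := by
    rw [hᾱ', add_pow_char, mul_pow, ← map_pow, ← map_pow, ZMod.pow_card, ZMod.pow_card, hα']
    have : ζ ^ (2 * p) = ζ ^ (3 * (2 * k + 1) + 1) := congrArg _ (by omega)
    rw [← pow_mul, this, pow_succ, hζk, one_mul]
  -- For `w = A + Bω`, the condition `A + B = 0` says exactly that `w = -ω * star w`.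
  have h1 : α ^ 3 = -ζ * ᾱ ^ 3 := by
    ext
    · simp [hα, hᾱ, hζ, pow_succ]; linear_combination hf
    · simp [hα, hᾱ, hζ, pow_succ]; linear_combination hf
  -- With `3 (k + 1) = p + 1`, the power `k + 1` turns both cubes into the norm `αᾱ`, leaving `(-ζ)
  -- ^ (k + 1) = 1`. This needs `3 ∣ k + 1`, that is `p ≡ 8 mod 9`.
  have h2 : α * ᾱ * (1 - (-ζ) ^ (k + 1)) = 0 := by
    have h3 := congrArg (· ^ (k + 1)) h1
    simp only [mul_pow, ← pow_mul] at h3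
    rw [show 3 * (k + 1) = p + 1 by omega, pow_succ α, pow_succ ᾱ, hfrob, hfrob'] at h3
    linear_combination h3
  have h4 : α * ᾱ = algebraMap (ZMod p) (EisensteinMod p) (u ^ 2 - u * v + v ^ 2) := by
    ext <;> simp [hα, hᾱ, pow_two] <;> ring
  have h5 : 1 - (-ζ) ^ (k + 1) = 0 := by
    rw [h4] at h2
    have := congrArg (algebraMap (ZMod p) (EisensteinMod p) (u ^ 2 - u * v + v ^ 2)⁻¹ * ·) h2
    simpa only [← mul_assoc, ← map_mul, inv_mul_cancel₀ hN, map_one, one_mul, mul_zero] using this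
  have h6 : ((-1) ^ (k + 1) * ζ ^ (k + 1)).im = 0 := by
    rw [← mul_pow, neg_one_mul]
    simpa using congrArg im h5
  have h7 : (ζ ^ (k + 1)).im = 0 := by
    rcases neg_one_pow_eq_or (EisensteinMod p) (k + 1) with h | h <;>
      rw [h] at h6 <;> simpa using h6
  have hk3 : (k + 1) % 3 = 1 ∨ (k + 1) % 3 = 2 := by
    simp only [Nat.ModEq] at hp9; omega
  rw [← Nat.div_add_mod (k + 1) 3, pow_add, hζk, one_mul] at h7
  rcases hk3 with h | h <;> rw [h] at h7 <;> simp [hζ, pow_succ] at h7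

end Eisenstein

/-! ### Cubes and prime powers in products of coprime integers -/

lemma Int.exists_cubes_of_mul_eq_cube {a b c : ℤ} (h : IsCoprime a b) (he : a * b = c ^ 3) :
    (∃ d, a = d ^ 3) ∧ ∃ d, b = d ^ 3 :=
  ⟨Int.eq_pow_of_mul_eq_pow_odd_left h (by decide) he,
    Int.eq_pow_of_mul_eq_pow_odd_right h (by decide) he⟩

lemma Int.prime_pow_dvd_or_dvd {p e : ℕ} (hp : p.Prime) {a b c : ℤ} (h : IsCoprime a b)
    (he : a * b = p ^ e * c) : (p : ℤ) ^ e ∣ a ∨ (p : ℤ) ^ e ∣ b := by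
  have hp' := Nat.prime_iff_prime_int.1 hp
  have hd : (p : ℤ) ^ e ∣ a * b := ⟨c, he⟩
  by_cases hb : (p : ℤ) ∣ b
  · have ha : ¬ (p : ℤ) ∣ a := fun ha ↦ hp'.not_isUnit (h.isUnit_of_dvd' ha hb)
    exact .inr (((hp'.coprime_iff_not_dvd.2 ha).pow_left).dvd_of_dvd_mul_left hd)
  · exact .inl (((hp'.coprime_iff_not_dvd.2 hb).pow_left).dvd_of_dvd_mul_right hd)

/-! ### The descent on `x³ + y³ = pᵉ qᶠ z³` -/

section Descent

open QuadraticAlgebra Eisenstein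

variable {p q e f : ℕ}

/-- Splitting `s * N(θ) = pᵉ qᶠ z³` with coprime factors, when `q` is inert. -/
lemma cube_or_cube_mod {θ : Eisenstein} {s z : ℤ} (hp : p.Prime) (hq : q.Prime) (hpq : p ≠ q)
    (he : e ≠ 0) (hf : f ≠ 0) (hp3 : p ≠ 3) (hq2 : q ≡ 2 [MOD 3])
    (hθ : IsCoprime θ.re θ.im) (hθ3 : 3 ∣ θ.im) (h3 : IsCoprime 3 θ.norm)
    (hs : IsCoprime s θ.norm) (hz : z ≠ 0) (h : s * θ.norm = p ^ e * q ^ f * z ^ 3) :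
    (∃ (α : Eisenstein) (a : ℤ), θ = α ^ 3 ∧ s = p ^ e * q ^ f * a ^ 3 ∧ a ≠ 0 ∧ a ∣ z) ∨
    (p ≡ 1 [MOD 3] ∧ ∃ (φ : Eisenstein →+* ZMod p) (c : ZMod p) (a : ℤ),
      φ θ = 0 ∧ φ (star θ) = c ^ 3 ∧ s = q ^ f * a ^ 3 ∧ ¬ (p : ℤ) ∣ a) := by
  have inert {l g : ℕ} (hl : l.Prime) (hg : g ≠ 0) (hl2 : l ≡ 2 [MOD 3]) :
      ¬ (l : ℤ) ^ g ∣ θ.norm := by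
    intro hd
    obtain ⟨h1, h2⟩ := dvd_of_dvd_norm hl hl2 ((dvd_pow_self _ hg).trans hd)
    exact (Nat.prime_iff_prime_int.1 hl).not_isUnit (hθ.isUnit_of_dvd' h1 h2)
  have hp0 : (p : ℤ) ^ e ≠ 0 := pow_ne_zero _ (by exact_mod_cast hp.ne_zero)
  have hq0 : (q : ℤ) ^ f ≠ 0 := pow_ne_zero _ (by exact_mod_cast hq.ne_zero)
  have hqs : (q : ℤ) ^ f ∣ s :=
    (Int.prime_pow_dvd_or_dvd hq hs (c := p ^ e * z ^ 3) (by rw [h]; ring)).resolve_right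
      (inert hq hf hq2)
  rcases Int.prime_pow_dvd_or_dvd hp hs (c := q ^ f * z ^ 3) (by rw [h]; ring) with hd | hd
  · left
    have hco : IsCoprime ((p : ℤ) ^ e) ((q : ℤ) ^ f) :=
      (Nat.isCoprime_iff_coprime.2 ((Nat.coprime_primes hp hq).2 hpq)).pow
    obtain ⟨s', rfl⟩ := hco.mul_dvd hd hqs
    have h1 : s' * θ.norm = z ^ 3 := by
      apply mul_left_cancel₀ (mul_ne_zero hp0 hq0)
      linear_combination h
    obtain ⟨⟨a, rfl⟩, b, hb⟩ := Int.exists_cubes_of_mul_eq_cube hs.of_mul_left_right h1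
    obtain ⟨α, hα⟩ := exists_eq_cube hθ hb h3 hθ3
    refine ⟨α, a, hα, rfl, ?_, ?_⟩
    · rintro rfl
      exact hz (by simpa using h1.symm)
    · rw [← Int.pow_dvd_pow_iff (three_ne_zero)]
      exact ⟨_, h1.symm⟩
  · right
    have hp1 : p ≡ 1 [MOD 3] := by
      by_contra hp1
      refine inert hp he ?_ hd
      have : p % 3 ≠ 0 := fun h0 ↦ hp3 ((Nat.prime_dvd_prime_iff_eq Nat.prime_three hp).1
        (Nat.dvd_of_mod_eq_zero h0)).symm
      simp only [Nat.ModEq] at hp1 ⊢; omega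
    obtain ⟨s', rfl⟩ := hqs
    obtain ⟨M, hM⟩ := hd
    have h1 : s' * M = z ^ 3 := by
      apply mul_left_cancel₀ (mul_ne_zero hp0 hq0)
      rw [hM] at h
      linear_combination h
    have hs' : IsCoprime s' M := by
      rw [hM] at hs
      exact hs.of_mul_left_right.of_mul_right_right
    obtain ⟨⟨a, rfl⟩, b, rfl⟩ := Int.exists_cubes_of_mul_eq_cube hs' h1
    have : Fact p.Prime := ⟨hp⟩
    obtain ⟨π, φ, c, hπ, hπ3, hφ, hφc⟩ := exists_norm_eq_prime hp1
    have hpa : ¬ (p : ℤ) ∣ a := by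
      intro hpa
      refine (Nat.prime_iff_prime_int.1 hp).not_isUnit (hs.isUnit_of_dvd'
        ((hpa.trans (dvd_pow_self _ three_ne_zero)).mul_left _) ?_)
      rw [hM]
      exact (dvd_pow_self _ he).mul_right _
    refine ⟨hp1, ?_⟩
    rcases exists_eq_pow_mul_cube hp he hθ hM h3 hθ3 hπ hπ3 with ⟨α, hα⟩ | ⟨α, hα⟩
    · refine ⟨φ, c ^ e * φ (star α), a, ?_, ?_, rfl, hpa⟩
      · rw [hα, map_mul, map_pow, hφ, zero_pow he, zero_mul]
      · rw [hα, star_mul, star_pow, star_pow, map_mul, map_pow, map_pow, hφc]; ring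
    -- Here `π` divides `star θ`, so the other prime above `p` is used.
    · refine ⟨φ.comp (starRingEnd Eisenstein), c ^ e * φ (star α), a, ?_, ?_, rfl, hpa⟩
      · rw [RingHom.comp_apply, starRingEnd_apply, hα, map_mul, map_pow, hφ, zero_pow he, zero_mul]
      · rw [RingHom.comp_apply, starRingEnd_apply, hα, star_mul, star_pow, star_pow, map_mul,
          map_pow, map_pow, hφc]; ring

lemma isCubeMod_of_pow (hp : p.Prime) (hpq : ¬ p ∣ q) (hf : f = 1 ∨ f = 2) {b : ZMod p}
    (h : (q : ZMod p) ^ f = b ^ 3) : IsCubeMod q p := by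
  have : Fact p.Prime := ⟨hp⟩
  rcases hf with rfl | rfl
  · exact ⟨b, by rw [← h, pow_one]⟩
  · have hq : (q : ZMod p) ≠ 0 := by rwa [Ne, ZMod.natCast_eq_zero_iff]
    -- From `q² = b³` one gets `(b² / q)³ = q⁴ / q³ = q`.
    refine ⟨b ^ 2 / q, ?_⟩
    field_simp
    linear_combination -(b ^ 3 + q ^ 2) * h

/-- The prime powers `pᵉ` and `qᶠ` satisfy the local conditions that make the descent on
`x³ + y³ = pᵉ qᶠ z³` succeed. -/
structure DescentData (p q e f : ℕ) : Prop where
  hp : p.Prime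
  hq : q.Prime
  hpq : p ≠ q
  he : e = 1 ∨ e = 2
  hf : f = 1 ∨ f = 2
  hp3 : p ≠ 3
  cubeFree : CubeFree (p ^ e * q ^ f)
  hq2 : q ≡ 2 [MOD 3]
  not_cube : p ≡ 1 [MOD 3] → ¬ IsCubeMod q p
  mod_nine : (p ^ e * q ^ f ≡ 1 [MOD 9] ∨ p ^ e * q ^ f ≡ 8 [MOD 9]) →
    p ≡ 2 [MOD 9] ∨ p ≡ 5 [MOD 9]
  no_sol : ∀ X Y Z : ℤ, IsCoprime X Y → IsCoprime Y Z →
    (p : ℤ) ^ e * X ^ 3 + (q : ℤ) ^ f * Y ^ 3 + Z ^ 3 ≠ 0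

/-- In the second alternative of `cube_or_cube_mod`, `φ` kills `θ` and makes `star θ` a cube. Since
`3√-3 = -(√-3)³`, either linear relation makes `s = qᶠ a³`, hence `q`, a cube modulo `p`. -/
lemma DescentData.eq_cube_of_trace_or_im (D : DescentData p q e f) {θ : Eisenstein} {s z : ℤ}
    (hθ : IsCoprime θ.re θ.im) (hθ3 : 3 ∣ θ.im) (h3 : IsCoprime 3 θ.norm)
    (hs : IsCoprime s θ.norm) (hz : z ≠ 0) (h : s * θ.norm = p ^ e * q ^ f * z ^ 3)
    (hor : θ.im = 3 * s ∨ 2 * θ.re - θ.im = - s ∨ ¬ p ≡ 1 [MOD 3]) :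
    ∃ (α : Eisenstein) (a : ℤ), θ = α ^ 3 ∧ s = p ^ e * q ^ f * a ^ 3 ∧ a ≠ 0 ∧ a ∣ z := by
  have he : e ≠ 0 := by rcases D.he with h | h <;> omega
  have hf : f ≠ 0 := by rcases D.hf with h | h <;> omega
  refine (cube_or_cube_mod D.hp D.hq D.hpq he hf D.hp3 D.hq2 hθ hθ3 h3 hs hz h).resolve_right ?_
  rintro ⟨hp1, φ, c, a, hφ, hφc, hsa, hpa⟩
  have : Fact p.Prime := ⟨D.hp⟩
  have ha0 : (a : ZMod p) ≠ 0 := by rwa [Ne, ZMod.intCast_zmod_eq_zero_iff_dvd]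
  have hpq : ¬ p ∣ q := fun hd ↦ D.hpq ((Nat.prime_dvd_prime_iff_eq D.hp D.hq).1 hd)
  have hsa' : (s : ZMod p) = (q : ZMod p) ^ f * a ^ 3 := by rw [hsa]; push_cast; rfl
  refine D.not_cube hp1 ?_
  rcases hor with hor | hor | hor
  · set δ : Eisenstein := ⟨1, 2⟩ with hδ
    have h1 : θ - star θ = (θ.im : ℤ) * δ := by ext <;> simp [hδ]; ring
    have h2 : δ * δ = -3 := by ext <;> simp [hδ]
    have h1' := congrArg φ h1
    have h2' := congrArg φ h2
    rw [hor] at h1'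
    simp only [map_sub, map_mul, map_neg, map_intCast, map_ofNat, hφ, hφc] at h1' h2'
    push_cast at h1'
    have hδ0 : φ δ ≠ 0 := by
      intro h0
      have : ((3 : ℕ) : ZMod p) = 0 := by push_cast; linear_combination h2' - φ δ * h0
      rw [ZMod.natCast_eq_zero_iff, Nat.prime_dvd_prime_iff_eq D.hp Nat.prime_three] at this
      exact D.hp3 this
    refine isCubeMod_of_pow D.hp hpq D.hf (b := c / (φ δ * a)) ?_
    rw [hsa'] at h1'
    field_simp
    linear_combination h1' + (q : ZMod p) ^ f * a ^ 3 * φ δ * h2'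
  · have h1 : θ + star θ = ((2 * θ.re - θ.im : ℤ) : Eisenstein) := by ext <;> simp; ring
    have h1' := congrArg φ h1
    rw [hor] at h1'
    simp only [map_add, map_intCast, hφ, hφc] at h1'
    push_cast at h1'
    refine isCubeMod_of_pow D.hp hpq D.hf (b := - c / a) ?_
    rw [hsa'] at h1'
    field_simp
    linear_combination h1'
  · exact absurd hp1 hor

lemma IsCoprime.of_eq {R : Type*} [CommSemiring R] {a b c d : R} (h : IsCoprime a b) (h₁ : a = c)
    (h₂ : b = d) : IsCoprime c d := h₁ ▸ h₂ ▸ h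

lemma Eisenstein.isCoprime_of_cube {α : Eisenstein} (h : IsCoprime (α ^ 3).re (α ^ 3).im) :
    IsCoprime α.re α.im := by
  obtain ⟨a, b, hab⟩ := h
  rw [cube_re, cube_im] at hab
  exact ⟨a * (α.re ^ 2 - 3 * α.im ^ 2), a * α.im ^ 2 + b * (3 * (α.re * (α.re - α.im))),
    by linear_combination hab⟩

lemma Int.isCoprime_three_of_not_dvd {a : ℤ} (h : ¬ (3 : ℤ) ∣ a) : IsCoprime 3 a :=
  Int.prime_three.coprime_iff_not_dvd.2 h

lemma Int.cube_emod_nine (t : ℤ) :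
    (3 ∣ t ∧ t ^ 3 % 9 = 0) ∨ (¬ 3 ∣ t ∧ (t ^ 3 % 9 = 1 ∨ t ^ 3 % 9 = 8)) := by
  have : t % 9 = 0 ∨ t % 9 = 1 ∨ t % 9 = 2 ∨ t % 9 = 3 ∨ t % 9 = 4 ∨ t % 9 = 5 ∨ t % 9 = 6 ∨
    t % 9 = 7 ∨ t % 9 = 8 := by omega
  rcases this with h | h | h | h | h | h | h | h | h <;> simp [pow_succ, Int.mul_emod, h] <;> omega

/-- The sum and the norm form at coprime arguments are coprime away from `3`. -/
lemma isCoprime_add_norm_form {x y : ℤ} (hxy : IsCoprime x y) (h3 : ¬ (3 : ℤ) ∣ x + y) :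
    IsCoprime (x + y) (x ^ 2 - x * y + y ^ 2) := by
  have h1 : IsCoprime (x + y) x := by simpa [add_comm] using (hxy.symm.add_mul_left_left 1)
  have h2 : IsCoprime (x + y) y := by simpa using (hxy.add_mul_left_left 1)
  have h4 : IsCoprime (x + y) (-(3 * (x * y))) :=
    ((Int.isCoprime_three_of_not_dvd h3).symm.mul_right (h1.mul_right h2)).neg_right
  have := h4.add_mul_left_right (x + y)
  exact this.of_eq (by ring) (by ring)

lemma DescentData.descent_of_dvd (D : DescentData p q e f)
    {x y z : ℤ} (hxy : IsCoprime x y) (hz : z ≠ 0)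
    (h : x ^ 3 + y ^ 3 = p ^ e * q ^ f * z ^ 3) (hz3 : 3 ∣ z) :
    ∃ u v w a : ℤ, a ≠ 0 ∧ a ∣ z ∧ IsCoprime u v ∧ u + v + w = 0 ∧
      u * v * w = p ^ e * q ^ f * a ^ 3 := by
  obtain ⟨z, rfl⟩ := hz3
  have h1 : (3 : ℤ) ∣ x + y := by
    refine Int.prime_three.dvd_of_dvd_pow (n := 3)
      ⟨p ^ e * q ^ f * 9 * z ^ 3 + x ^ 2 * y + x * y ^ 2, ?_⟩
    linear_combination h
  obtain ⟨t, ht⟩ := h1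
  obtain rfl : x = 3 * t - y := by linarith
  have hy3 : ¬ (3 : ℤ) ∣ y := fun hd ↦ Int.prime_three.not_isUnit
    (hxy.isUnit_of_dvd' (dvd_sub (dvd_mul_right _ _) hd) hd)
  have h2 : t * (3 * t ^ 2 - (3 * t - y) * y) = 3 * (p ^ e * q ^ f * z ^ 3) := by
    have : 9 * (t * (3 * t ^ 2 - (3 * t - y) * y)) = 9 * (3 * (p ^ e * q ^ f * z ^ 3)) := by
      linear_combination h
    linarith
  have h3 : (3 : ℤ) ∣ t := by
    rcases Int.prime_three.dvd_or_dvd (⟨_, h2⟩ : (3 : ℤ) ∣ _) with h3 | h3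
    · exact h3
    · refine absurd (Int.prime_three.dvd_of_dvd_pow (n := 2) ?_) hy3
      obtain ⟨m, hm⟩ := h3
      exact ⟨m - t ^ 2 + t * y, by linear_combination hm⟩
  obtain ⟨s, rfl⟩ := h3
  have hys : IsCoprime y (9 * s) := by
    have := hxy.symm.add_mul_left_right 1
    exact this.of_eq (by ring) (by ring)
  have hy_s : IsCoprime y s := hys.of_mul_right_right
  have hy_3 : IsCoprime y 3 := (Int.isCoprime_three_of_not_dvd hy3).symm
  -- This is `(x + yω) / (1 - ω)` with `x = 9s - y`.
  set θ : Eisenstein := ⟨6 * s - y, 3 * s⟩ with hθ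
  have hN : θ.norm = y ^ 2 - 9 * s * y + 27 * s ^ 2 := by
    rw [norm_eq]; simp only [hθ]; ring
  obtain ⟨α, a, hα, hsa, ha, haz⟩ := D.eq_cube_of_trace_or_im (θ := θ) (s := s) (z := z)
    (by
      have := ((hy_3.mul_right hy_s).neg_left.add_mul_left_left 2)
      exact this.of_eq (show _ = 6 * s - y by ring) rfl)
    (dvd_mul_right _ _)
    (by
      rw [hN]
      have := (hy_3.symm.pow_right (n := 2)).add_mul_left_right (-3 * s * y + 9 * s ^ 2)
      exact this.of_eq (by ring) (by ring))
    (by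
      rw [hN]
      have := (hy_s.symm.pow_right (n := 2)).add_mul_left_right (-9 * y + 27 * s)
      exact this.of_eq (by ring) (by ring))
    (by rintro rfl; simp at hz)
    (by
      rw [hN]
      have : 3 * (s * (y ^ 2 - 9 * s * y + 27 * s ^ 2)) = 3 * (p ^ e * q ^ f * z ^ 3) := by
        linear_combination h2
      linarith)
    (.inl rfl)
  have hs : α.re * α.im * (α.re - α.im) = s := by
    have := cube_im α
    rw [← hα] at this
    simp only [hθ] at this
    linarith
  have hco : IsCoprime α.re α.im := by
    apply isCoprime_of_cube
    rw [← hα]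
    have := ((hy_3.mul_right hy_s).neg_left.add_mul_left_left 2)
    exact this.of_eq (show _ = 6 * s - y by ring) rfl
  -- The three forms come from `Im α³ = 3 re im (re - im)`.
  exact ⟨α.re, -α.im, α.im - α.re, a, ha, haz.mul_left _, hco.neg_right, by ring,
    by rw [← hsa, ← hs]; ring⟩

lemma DescentData.descent_of_modEq (D : DescentData p q e f)
    {x y z : ℤ} (hxy : IsCoprime x y) (hz : z ≠ 0)
    (h : x ^ 3 + y ^ 3 = p ^ e * q ^ f * z ^ 3) (h3 : ¬ (3 : ℤ) ∣ x + y) (hd : 3 ∣ x - y) :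
    ∃ u v w a : ℤ, a ≠ 0 ∧ a ∣ z ∧ IsCoprime u v ∧ u + v + w = 0 ∧
      u * v * w = p ^ e * q ^ f * a ^ 3 := by
  -- This is `ω (x + yω)`, whose trace is `-(x + y)`; the trace of `α³` again splits into three
  -- linear forms.
  set θ : Eisenstein := ⟨-y, x - y⟩ with hθ
  have hN : θ.norm = x ^ 2 - x * y + y ^ 2 := by
    rw [norm_eq]; simp only [hθ]; ring
  have hco : IsCoprime θ.re θ.im := by
    have := hxy.symm.neg_left.add_mul_left_right 1
    exact this.of_eq rfl (show _ = x - y by ring)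
  obtain ⟨α, a, hα, hsa, ha, haz⟩ := D.eq_cube_of_trace_or_im (θ := θ) (s := x + y) (z := z) hco
    hd
    (by
      rw [hN]
      have := ((Int.isCoprime_three_of_not_dvd h3).pow_right (n := 2)).add_mul_left_right (-x * y)
      exact this.of_eq (by ring) (by ring))
    (by rw [hN]; exact isCoprime_add_norm_form hxy h3)
    hz (by rw [hN, ← h]; ring) (.inr (.inl (by simp only [hθ]; ring)))
  rw [hα] at hco
  have hco' := isCoprime_of_cube hco
  have hs : (α.re + α.im) * (2 * α.re - α.im) * (α.re - 2 * α.im) = -(x + y) := by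
    have h1 := cube_im α
    have h2 := cube_re α
    rw [← hα] at h1 h2
    simp only [hθ] at h1 h2
    linear_combination -2 * h2 + h1
  have h3' : ¬ (3 : ℤ) ∣ α.re + α.im := fun h0 ↦ h3 (by
    rw [← dvd_neg, ← hs, mul_assoc]; exact h0.mul_right _)
  refine ⟨α.re + α.im, α.im - 2 * α.re, α.re - 2 * α.im, a, ha, haz, ?_, by ring,
    by rw [← hsa]; linear_combination -hs⟩
  have h4 : IsCoprime (α.re + α.im) α.im := by simpa using hco'.add_mul_left_left 1
  have := ((Int.isCoprime_three_of_not_dvd h3').symm.mul_right h4).add_mul_left_right (-2)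
  exact this.of_eq (by ring) (by ring)

/-- Here `x + yω` is already an integer modulo `3`, so it is a cube `α³` with `p ∣ x + y`, against
`not_dvd_cube_re_add_im`. -/
lemma DescentData.not_dvd_right (D : DescentData p q e f)
    {x y z : ℤ} (hxy : IsCoprime x y) (hz : z ≠ 0)
    (h : x ^ 3 + y ^ 3 = p ^ e * q ^ f * z ^ 3) (h3 : ¬ (3 : ℤ) ∣ x + y)
    (hp9 : p ≡ 2 [MOD 9] ∨ p ≡ 5 [MOD 9]) : ¬ 3 ∣ y := by
  intro hd
  set θ : Eisenstein := ⟨x, y⟩ with hθ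
  have hN : θ.norm = x ^ 2 - x * y + y ^ 2 := norm_eq _
  obtain ⟨α, a, hα, hsa, -, -⟩ := D.eq_cube_of_trace_or_im (θ := θ) (s := x + y) (z := z) hxy
    hd
    (by
      rw [hN]
      have := ((Int.isCoprime_three_of_not_dvd h3).pow_right (n := 2)).add_mul_left_right (-x * y)
      exact this.of_eq (by ring) (by ring))
    (by rw [hN]; exact isCoprime_add_norm_form hxy h3)
    hz (by rw [hN, ← h]; ring)
    (.inr (.inr (by simp only [Nat.ModEq] at hp9 ⊢; omega)))
  have hco : IsCoprime (α ^ 3).re (α ^ 3).im := by rw [← hα]; exact hxy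
  refine not_dvd_cube_re_add_im D.hp hp9 (isCoprime_of_cube hco) ?_
  rw [← hα]
  show (p : ℤ) ∣ x + y
  rw [hsa, mul_assoc]
  exact (dvd_pow_self _ (by rcases D.he with h | h <;> omega)).mul_right _

lemma DescentData.descent (D : DescentData p q e f) {x y z : ℤ} (hxy : IsCoprime x y) (hz : z ≠ 0)
    (h : x ^ 3 + y ^ 3 = p ^ e * q ^ f * z ^ 3) :
    ∃ u v w a : ℤ, a ≠ 0 ∧ a ∣ z ∧ IsCoprime u v ∧ u + v + w = 0 ∧
      u * v * w = p ^ e * q ^ f * a ^ 3 := by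
  by_cases hz3 : (3 : ℤ) ∣ z
  · exact D.descent_of_dvd hxy hz h hz3
  have hn3 : ¬ (3 : ℤ) ∣ p ^ e * q ^ f := by
    have := D.hq2
    have := D.hp3
    intro hd
    rcases Int.prime_three.dvd_or_dvd hd with hd | hd
    · have : 3 ∣ p := by exact_mod_cast Int.prime_three.dvd_of_dvd_pow hd
      exact D.hp3 ((Nat.prime_dvd_prime_iff_eq Nat.prime_three D.hp).1 this).symm
    · have h1 : 3 ∣ q := by exact_mod_cast Int.prime_three.dvd_of_dvd_pow hd
      have := D.hq2
      simp only [Nat.ModEq] at this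
      omega
  have h3 : ¬ (3 : ℤ) ∣ x + y := by
    intro h0
    have h1 : (3 : ℤ) ∣ p ^ e * q ^ f * z ^ 3 := by
      rw [← h, show x ^ 3 + y ^ 3 = (x + y) * (x ^ 2 - x * y + y ^ 2) by ring]
      exact h0.mul_right _
    rcases Int.prime_three.dvd_or_dvd h1 with hd | hd
    · exact hn3 hd
    · exact hz3 (Int.prime_three.dvd_of_dvd_pow hd)
  by_cases hd : 3 ∣ x - y
  · exact D.descent_of_modEq hxy hz h h3 hd
  exfalso
  have hor : 3 ∣ x ∨ 3 ∣ y := by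
    have hx : x % 3 = 0 ∨ x % 3 = 1 ∨ x % 3 = 2 := by omega
    have hy : y % 3 = 0 ∨ y % 3 = 1 ∨ y % 3 = 2 := by omega
    rcases hx with hx | hx | hx <;> rcases hy with hy | hy | hy <;> omega
  -- Exactly one of `x, y` is divisible by `3`, so `x³ + y³ ≡ ±1` and `z³ ≡ ±1` modulo `9`.
  have hn9 : (p ^ e * q ^ f ≡ 1 [MOD 9] ∨ p ^ e * q ^ f ≡ 8 [MOD 9]) := by
    set N := p ^ e * q ^ f with hN
    have hN' : (p : ℤ) ^ e * q ^ f = (N : ℕ) := by rw [hN]; push_cast; rfl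
    rw [hN'] at h
    have h9 := congrArg (· % 9) h
    simp only [Nat.ModEq]
    have hz9 := Int.cube_emod_nine z
    have hx9 := Int.cube_emod_nine x
    have hy9 := Int.cube_emod_nine y
    have e1 : (N : ℤ) * z ^ 3 % 9 = (N % 9) * (z ^ 3 % 9) % 9 := Int.mul_emod _ _ _
    rw [e1] at h9
    rcases hz9 with hz9 | ⟨-, hz9 | hz9⟩
    · exact absurd hz9.1 hz3
    all_goals rw [hz9] at h9; omega
  rcases hor with hx | hy
  · exact D.not_dvd_right hxy.symm hz (by rw [← h]; ring) (by rwa [add_comm]) (D.mod_nine hn9) hx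
  · exact D.not_dvd_right hxy hz h h3 (D.mod_nine hn9) hy

/-- From a factorisation into three coprime factors with sum zero to a new solution. -/
lemma DescentData.exists_of_mul_eq (D : DescentData p q e f)
    {u v w a : ℤ} (huv : IsCoprime u v) (hs : u + v + w = 0)
    (h : u * v * w = p ^ e * q ^ f * a ^ 3) :
    ∃ X Y Z : ℤ, IsCoprime X Y ∧ X ^ 3 + Y ^ 3 = p ^ e * q ^ f * Z ^ 3 ∧ X * Y * Z = -a := by
  have hp0 : (p : ℤ) ^ e ≠ 0 := pow_ne_zero _ (by exact_mod_cast D.hp.ne_zero)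
  have hq0 : (q : ℤ) ^ f ≠ 0 := pow_ne_zero _ (by exact_mod_cast D.hq.ne_zero)
  have hco : IsCoprime ((p : ℤ) ^ e) ((q : ℤ) ^ f) :=
    (Nat.isCoprime_iff_coprime.2 ((Nat.coprime_primes D.hp D.hq).2 D.hpq)).pow
  have third {u v w : ℤ} (huv : IsCoprime u v) (hs : u + v + w = 0) :
      IsCoprime u w ∧ IsCoprime v w := by
    obtain rfl : w = -(u + v) := by linarith
    constructor
    · have := (huv.add_mul_left_right 1).neg_right
      exact this.of_eq (by ring) (by ring)
    · have := (huv.symm.add_mul_left_right 1).neg_right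
      exact this.of_eq (by ring) (by ring)
  -- `pᵉ` and `qᶠ` in different factors: the case ruled out by `no_sol`.
  have mixed {u v w : ℤ} (huv : IsCoprime u v) (hs : u + v + w = 0)
      (h : u * v * w = p ^ e * q ^ f * a ^ 3) (hu : (p : ℤ) ^ e ∣ u) : ¬ (q : ℤ) ^ f ∣ v := by
    rintro ⟨v, rfl⟩
    obtain ⟨u, rfl⟩ := hu
    obtain ⟨h1, h2⟩ := third huv hs
    have h3 : u * v * w = a ^ 3 := by
      apply mul_left_cancel₀ (mul_ne_zero hp0 hq0)
      linear_combination h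
    have huv' := huv.of_mul_left_right.of_mul_right_right
    have h1' := h1.of_mul_left_right
    have h2' := h2.of_mul_left_right
    obtain ⟨⟨uv, huv3⟩, Z, rfl⟩ := Int.exists_cubes_of_mul_eq_cube (h1'.mul_left h2') h3
    obtain ⟨⟨X, rfl⟩, Y, rfl⟩ := Int.exists_cubes_of_mul_eq_cube huv' huv3
    exact D.no_sol X Y Z ((IsCoprime.pow_iff three_pos three_pos).1 huv')
      ((IsCoprime.pow_iff three_pos three_pos).1 h2') hs
  have same {u v w : ℤ} (huv : IsCoprime u v) (hs : u + v + w = 0)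
      (h : u * v * w = p ^ e * q ^ f * a ^ 3) (hu : (p : ℤ) ^ e ∣ u) (hu' : (q : ℤ) ^ f ∣ u) :
      ∃ X Y Z : ℤ, IsCoprime X Y ∧ X ^ 3 + Y ^ 3 = p ^ e * q ^ f * Z ^ 3 ∧ X * Y * Z = -a := by
    obtain ⟨u, rfl⟩ := hco.mul_dvd hu hu'
    obtain ⟨h1, h2⟩ := third huv hs
    have h3 : u * v * w = a ^ 3 := by
      apply mul_left_cancel₀ (mul_ne_zero hp0 hq0)
      linear_combination h
    have huv' := huv.of_mul_left_right
    have h1' := h1.of_mul_left_right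
    obtain ⟨⟨uv, huv3⟩, Z, rfl⟩ := Int.exists_cubes_of_mul_eq_cube (h1'.mul_left h2) h3
    obtain ⟨⟨X, rfl⟩, Y, rfl⟩ := Int.exists_cubes_of_mul_eq_cube huv' huv3
    refine ⟨Y, Z, -X, (IsCoprime.pow_iff three_pos three_pos).1 h2, by linear_combination hs, ?_⟩
    have : (X * Y * Z) ^ 3 = a ^ 3 := by rw [← h3]; ring
    have := (Odd.strictMono_pow (R := ℤ) (n := 3) (by decide)).injective this
    rw [← this]; ring
  have main {u v w : ℤ} (huv : IsCoprime u v) (hs : u + v + w = 0)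
      (h : u * v * w = p ^ e * q ^ f * a ^ 3) (hu : (p : ℤ) ^ e ∣ u) :
      ∃ X Y Z : ℤ, IsCoprime X Y ∧ X ^ 3 + Y ^ 3 = p ^ e * q ^ f * Z ^ 3 ∧ X * Y * Z = -a := by
    obtain ⟨h1, h2⟩ := third huv hs
    rcases Int.prime_pow_dvd_or_dvd D.hq (e := f) (huv.mul_right h1) (c := p ^ e * a ^ 3)
      (by linear_combination h) with hd | hd
    · exact same huv hs h hu hd
    · exfalso
      obtain ⟨c, hc⟩ := hd
      rcases Int.prime_pow_dvd_or_dvd D.hq (e := f) h2 hc with hd | hd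
      · exact mixed huv hs h hu hd
      · exact mixed (w := v) h1 (by linarith) (by linear_combination h) hu hd
  obtain ⟨h1, h2⟩ := third huv hs
  rcases Int.prime_pow_dvd_or_dvd D.hp (e := e) (huv.mul_right h1) (c := q ^ f * a ^ 3)
      (by linear_combination h) with hd | hd
  · exact main huv hs h hd
  · obtain ⟨c, hc⟩ := hd
    rcases Int.prime_pow_dvd_or_dvd D.hp h2 hc with hd | hd
    · exact main (w := w) huv.symm (by linarith) (by linear_combination h) hd
    · exact main (w := v) h1.symm (by linarith) (by linear_combination h) hd

/-- Since `|XY| |Z| = |a| ≤ |z|`, the new solution is smaller unless `X` and `Y` are units; but then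
`X³ + Y³` is `0` or `±2`, while it is a nonzero multiple of `pq ≥ 4`. -/
lemma DescentData.false_of_coprime (D : DescentData p q e f)
    (m : ℕ) {x y z : ℤ} (hm : z.natAbs = m) (hxy : IsCoprime x y)
    (hz : z ≠ 0) (h : x ^ 3 + y ^ 3 = p ^ e * q ^ f * z ^ 3) : False := by
  induction m using Nat.strong_induction_on generalizing x y z with
  | _ m ih =>
    obtain ⟨u, v, w, a, ha, haz, huv, hs, huvw⟩ := D.descent hxy hz h
    obtain ⟨X, Y, Z, hXY, hXYZ, hprod⟩ := D.exists_of_mul_eq huv hs huvw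
    have hprod0 : X * Y * Z ≠ 0 := by rw [hprod]; exact neg_ne_zero.2 ha
    have hZ : Z ≠ 0 := right_ne_zero_of_mul hprod0
    have hXY0 : X * Y ≠ 0 := left_ne_zero_of_mul hprod0
    refine ih Z.natAbs ?_ rfl hXY hZ hXYZ
    have h1 : (X * Y).natAbs * Z.natAbs ≤ m := by
      rw [← Int.natAbs_mul, hprod, Int.natAbs_neg, ← hm]
      exact Nat.le_of_dvd (Int.natAbs_pos.2 hz) (Int.natAbs_dvd_natAbs.2 haz)
    have h2 : (X * Y).natAbs ≠ 1 := by
      intro h0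
      have hXu : X = 1 ∨ X = -1 := Int.isUnit_iff.1
        (isUnit_of_mul_isUnit_left (Int.isUnit_iff_natAbs_eq.2 h0))
      have hYu : Y = 1 ∨ Y = -1 := Int.isUnit_iff.1
        (isUnit_of_mul_isUnit_right (Int.isUnit_iff_natAbs_eq.2 h0))
      have hd : ((p * q : ℕ) : ℤ) ∣ X ^ 3 + Y ^ 3 := by
        rw [hXYZ]; push_cast
        exact (mul_dvd_mul (dvd_pow_self _ (by rcases D.he with h | h <;> omega))
          (dvd_pow_self _ (by rcases D.hf with h | h <;> omega))).mul_right _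
      have hne : X ^ 3 + Y ^ 3 ≠ 0 := by
        rw [hXYZ]
        refine mul_ne_zero (mul_ne_zero (pow_ne_zero _ ?_) (pow_ne_zero _ ?_)) (pow_ne_zero _ hZ)
        · exact_mod_cast D.hp.ne_zero
        · exact_mod_cast D.hq.ne_zero
      have hle := Nat.le_of_dvd (Int.natAbs_pos.2 hne) (Int.natCast_dvd.1 hd)
      have h4 : 4 ≤ p * q := Nat.mul_le_mul D.hp.two_le D.hq.two_le
      rcases hXu with rfl | rfl <;> rcases hYu with rfl | rfl <;> norm_num at hle hne <;> omega
    have h3 : 0 < (X * Y).natAbs := Int.natAbs_pos.2 hXY0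
    have h4 : 0 < Z.natAbs := Int.natAbs_pos.2 hZ
    nlinarith [show 2 ≤ (X * Y).natAbs by omega]

/-- No nonzero multiple of a cube by `pᵉ qᶠ` is a sum of two integral cubes. -/
theorem DescentData.cube_add_cube_ne (D : DescentData p q e f) {x y z : ℤ} (hz : z ≠ 0) :
    x ^ 3 + y ^ 3 ≠ p ^ e * q ^ f * z ^ 3 := by
  intro h
  have hxy0 : x ≠ 0 ∨ y ≠ 0 := by
    by_contra! h0
    rw [h0.1, h0.2] at h
    have hp0 : (p : ℤ) ≠ 0 := by exact_mod_cast D.hp.ne_zero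
    have hq0 : (q : ℤ) ≠ 0 := by exact_mod_cast D.hq.ne_zero
    have : (p : ℤ) ^ e * q ^ f * z ^ 3 ≠ 0 := by positivity
    exact this (by rw [← h]; norm_num)
  obtain ⟨g, x', y', hg, hco, rfl, rfl⟩ : ∃ g x' y' : ℤ, g ≠ 0 ∧ IsCoprime x' y' ∧
      x = g * x' ∧ y = g * y' := by
    obtain ⟨x', y', hx, hy, hu⟩ := extract_gcd x y
    refine ⟨gcd x y, x', y', ?_, (gcd_isUnit_iff _ _).1 hu, hx, hy⟩
    rw [Ne, gcd_eq_zero_iff]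
    tauto
  obtain ⟨g', z', hg', hz', hu⟩ := extract_gcd g z
  have hk : gcd g z ≠ 0 := by rw [Ne, gcd_eq_zero_iff]; tauto
  set k := gcd g z
  have h1 : g' ^ 3 * (x' ^ 3 + y' ^ 3) = p ^ e * q ^ f * z' ^ 3 := by
    apply mul_left_cancel₀ (pow_ne_zero 3 hk)
    rw [hg', hz'] at h
    linear_combination h
  -- What remains of the common factor of `x, y` is prime to `z'`, so its cube divides a cube-free
  -- integer.
  have h2 : g' ^ 3 ∣ p ^ e * q ^ f :=
    (((gcd_isUnit_iff _ _).1 hu).pow).dvd_of_dvd_mul_right ⟨_, h1.symm⟩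
  have h3 : g'.natAbs = 1 := by
    by_contra hne
    obtain ⟨l, hl, hlg⟩ := Nat.exists_prime_and_dvd hne
    refine D.cubeFree l hl ?_
    have := (pow_dvd_pow_of_dvd (Int.natCast_dvd.2 hlg) 3).trans h2
    exact_mod_cast this
  have hz0 : z' ≠ 0 := by rintro rfl; rw [mul_zero] at hz'; exact hz hz'
  rcases Int.natAbs_eq_iff.1 h3 with rfl | rfl
  · exact D.false_of_coprime _ rfl hco hz0 (by linear_combination h1)
  · exact D.false_of_coprime _ rfl hco (neg_ne_zero.2 hz0) (by linear_combination -h1)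

end Descent

/-! ### The local conditions in the four cases -/

lemma Int.cube_combination_ne_zero {a b X Y Z : ℤ}
    (hab : (a % 9 = 2 ∧ b % 9 = 5) ∨ (a % 9 = 4 ∧ b % 9 = 7) ∨ (a % 9 = 4 ∧ b % 9 = 2) ∨
      (a % 9 = 7 ∧ b % 9 = 5)) (hXY : IsCoprime X Y) : a * X ^ 3 + b * Y ^ 3 + Z ^ 3 ≠ 0 := by
  intro h
  have hX := Int.cube_emod_nine X
  have hY := Int.cube_emod_nine Y
  have hZ := Int.cube_emod_nine Z
  have hne : ¬ (3 ∣ X ∧ 3 ∣ Y) := fun h ↦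
    Int.prime_three.not_isUnit (hXY.isUnit_of_dvd' h.1 h.2)
  have h9 : (a % 9 * (X ^ 3 % 9) + b % 9 * (Y ^ 3 % 9) + Z ^ 3 % 9) % 9 = 0 := by
    have := congrArg (· % 9) h
    simpa [Int.add_emod, Int.mul_emod] using this
  rcases hab with ⟨ha, hb⟩ | ⟨ha, hb⟩ | ⟨ha, hb⟩ | ⟨ha, hb⟩ <;> rw [ha, hb] at h9 <;> omega

/-- Both primes are inert, so the cubic residue condition is vacuous and the obstruction lies modulo
`9`. -/
lemma DescentData.of_modEq {p q e f : ℕ} (hp : p.Prime) (hq : q.Prime) (hpq : p ≠ q)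
    (he : e = 1 ∨ e = 2) (hf : f = 1 ∨ f = 2) (hcf : CubeFree (p ^ e * q ^ f))
    (hp9 : p ≡ 2 [MOD 9] ∨ p ≡ 5 [MOD 9]) (hq9 : q ≡ 2 [MOD 9] ∨ q ≡ 5 [MOD 9])
    (h : (p ^ e % 9 = 2 ∧ q ^ f % 9 = 5) ∨ (p ^ e % 9 = 4 ∧ q ^ f % 9 = 7) ∨
      (p ^ e % 9 = 4 ∧ q ^ f % 9 = 2) ∨ (p ^ e % 9 = 7 ∧ q ^ f % 9 = 5)) :
    DescentData p q e f where
  hp := hp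
  hq := hq
  hpq := hpq
  he := he
  hf := hf
  hp3 := by rintro rfl; simp [Nat.ModEq] at hp9
  cubeFree := hcf
  hq2 := by simp only [Nat.ModEq] at hq9 ⊢; omega
  not_cube h1 := by simp only [Nat.ModEq] at hp9 h1; omega
  mod_nine _ := hp9
  no_sol X Y Z hXY _ := Int.cube_combination_ne_zero (by exact_mod_cast h) hXY

/-- Modulo `p` the forbidden equation reads `qᶠ = (-Z / Y)³`. The condition at `9` is vacuous. -/
lemma DescentData.of_not_isCubeMod {p q e f : ℕ} (hp : p.Prime) (hq : q.Prime) (hpq : p ≠ q)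
    (he : e = 1 ∨ e = 2) (hf : f = 1 ∨ f = 2) (hcf : CubeFree (p ^ e * q ^ f))
    (hp1 : p ≡ 1 [MOD 3]) (hq2 : q ≡ 2 [MOD 3]) (hqp : ¬ IsCubeMod q p)
    (h1 : ¬ p ^ e * q ^ f ≡ 1 [MOD 9]) (h8 : ¬ p ^ e * q ^ f ≡ 8 [MOD 9]) :
    DescentData p q e f where
  hp := hp
  hq := hq
  hpq := hpq
  he := he
  hf := hf
  hp3 := by rintro rfl; simp [Nat.ModEq] at hp1
  cubeFree := hcf
  hq2 := hq2
  not_cube _ := hqp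
  mod_nine h := absurd h (by tauto)
  no_sol X Y Z _ hYZ h := by
    have : Fact p.Prime := ⟨hp⟩
    have he0 : e ≠ 0 := by omega
    have h' := congrArg (Int.cast (R := ZMod p)) h
    push_cast at h'
    rw [ZMod.natCast_self, zero_pow he0, zero_mul, zero_add] at h'
    by_cases hY : (Y : ZMod p) = 0
    · have hZ : (Z : ZMod p) = 0 := by simpa [hY] using h'
      rw [ZMod.intCast_zmod_eq_zero_iff_dvd] at hY hZ
      exact (Nat.prime_iff_prime_int.1 hp).not_isUnit (hYZ.isUnit_of_dvd' hY hZ)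
    · refine hqp (isCubeMod_of_pow hp
        (fun hd ↦ hpq ((Nat.prime_dvd_prime_iff_eq hp hq).1 hd)) hf (b := -Z / Y) ?_)
      field_simp
      linear_combination h'

/-! ### From integral cubes to rational points on the curve -/

lemma not_isRationalCubeSum_of_forall {n : ℕ}
    (h : ∀ x y z : ℤ, z ≠ 0 → x ^ 3 + y ^ 3 ≠ n * z ^ 3) : ¬ IsRationalCubeSum n := by
  rintro ⟨x, y, hxy⟩
  refine h (x.num * y.den) (y.num * x.den) (x.den * y.den) (by simp) ?_
  have hx : (x.den : ℚ) ≠ 0 := by simp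
  have hy : (y.den : ℚ) ≠ 0 := by simp
  rw [← Rat.num_div_den x, ← Rat.num_div_den y] at hxy
  field_simp at hxy
  have : ((x.num * y.den) ^ 3 + (y.num * x.den) ^ 3 : ℚ) = n * (x.den * y.den) ^ 3 := by
    linear_combination hxy
  exact_mod_cast this

/-- If `n` is not a sum of two rational cubes, then `y² = x³ - 432 n²` has no affine rational
point. -/
lemma subsingleton_point_mordellCurve {n : ℕ} (hn : n ≠ 0) (h : ¬ IsRationalCubeSum n) :
    Subsingleton (mordellCurve (-432 * (n : ℚ) ^ 2)).Point := by
  refine subsingleton_of_forall_eq 0 fun P ↦ ?_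
  match P with
  | .zero => rfl
  | .some x y hP =>
    exfalso
    have heq := hP.1
    rw [WeierstrassCurve.Affine.equation_iff] at heq
    simp only [mordellCurve, zero_mul, add_zero] at heq
    have hn' : (0 : ℚ) < n := by exact_mod_cast Nat.pos_of_ne_zero hn
    have hx : x ≠ 0 := by
      rintro rfl
      nlinarith [sq_nonneg y, pow_pos hn' 2]
    -- The inverse of the birational map from `X³ + Y³ = n`; the cubes add up to `n (y² + 432 n²) /
    -- x³ = n`.
    refine h ⟨(36 * n + y) / (6 * x), (36 * n - y) / (6 * x), ?_⟩
    field_simp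
    linear_combination 216 * n * heq

theorem theorem3p1 (n ℓ₁ ℓ₂ : ℕ) (hn : CubeFree n) (hn3 : Nat.Coprime n 3)
    (hne : ℓ₁ ≠ ℓ₂) (hfac : n.primeFactors = {ℓ₁, ℓ₂})
    (hcases :
      ((n = ℓ₁ * ℓ₂ ∨ n = ℓ₁ ^ 2 * ℓ₂ ^ 2) ∧ ℓ₁ ≡ 2 [MOD 9] ∧ ℓ₂ ≡ 5 [MOD 9]) ∨
      (n = ℓ₁ ^ 2 * ℓ₂ ∧
        ((ℓ₁ ≡ 2 [MOD 9] ∧ ℓ₂ ≡ 2 [MOD 9]) ∨ (ℓ₁ ≡ 5 [MOD 9] ∧ ℓ₂ ≡ 5 [MOD 9]))) ∨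
      ((n = ℓ₁ * ℓ₂ ∨ n = ℓ₁ ^ 2 * ℓ₂) ∧ (n ≡ 2 [MOD 9] ∨ n ≡ 5 [MOD 9]) ∧
        ℓ₁ ≡ 1 [MOD 3] ∧ ℓ₂ ≡ 2 [MOD 3] ∧ ¬ IsCubeMod ℓ₂ ℓ₁) ∨
      ((n = ℓ₁ ^ 2 * ℓ₂ ^ 2 ∨ n = ℓ₁ * ℓ₂ ^ 2) ∧ (n ≡ 4 [MOD 9] ∨ n ≡ 7 [MOD 9]) ∧
        ℓ₁ ≡ 1 [MOD 3] ∧ ℓ₂ ≡ 2 [MOD 3] ∧ ¬ IsCubeMod ℓ₂ ℓ₁)) :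
    mordellWeilRank (mordellCurve (-432 * (n : ℚ) ^ 2)) = 0 ∧ ¬ IsRationalCubeSum n := by
  have h₁ : ℓ₁ ∈ n.primeFactors := by rw [hfac]; simp
  have h₂ : ℓ₂ ∈ n.primeFactors := by rw [hfac]; simp
  have hn0 : n ≠ 0 := (Nat.mem_primeFactors.1 h₁).2.2
  have hp := Nat.prime_of_mem_primeFactors h₁
  have hq := Nat.prime_of_mem_primeFactors h₂
  obtain ⟨e, f, rfl, D⟩ : ∃ e f, n = ℓ₁ ^ e * ℓ₂ ^ f ∧ DescentData ℓ₁ ℓ₂ e f := by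
    rcases hcases with ⟨hn', h2, h5⟩ | ⟨hn', h⟩ | ⟨hn', h9, h1, h2, h⟩ | ⟨hn', h9, h1, h2, h⟩
    · obtain ⟨e, he, hn'⟩ : ∃ e, (e = 1 ∨ e = 2) ∧ n = ℓ₁ ^ e * ℓ₂ ^ e := by
        rcases hn' with h | h
        · exact ⟨1, by simp, by simpa using h⟩
        · exact ⟨2, by simp, h⟩
      refine ⟨e, e, hn', .of_modEq hp hq hne he he (hn' ▸ hn) (.inl h2) (.inr h5) ?_⟩
      rw [Nat.ModEq] at h2 h5
      rcases he with rfl | rfl <;> simp [Nat.pow_mod, h2, h5]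
    · have hn'' : n = ℓ₁ ^ 2 * ℓ₂ ^ 1 := by simpa using hn'
      refine ⟨2, 1, hn'', .of_modEq hp hq hne (by simp) (by simp) (hn'' ▸ hn) (by tauto) (by tauto)
        ?_⟩
      simp only [Nat.ModEq] at h
      rcases h with ⟨h, h'⟩ | ⟨h, h'⟩ <;> simp [Nat.pow_mod, h, h']
    · obtain ⟨e, he, hn'⟩ : ∃ e, (e = 1 ∨ e = 2) ∧ n = ℓ₁ ^ e * ℓ₂ ^ 1 := by
        rcases hn' with h | h
        · exact ⟨1, by simp, by simpa using h⟩
        · exact ⟨2, by simp, by simpa using h⟩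
      refine ⟨e, 1, hn', .of_not_isCubeMod hp hq hne he (by simp) (hn' ▸ hn) h1 h2 h ?_ ?_⟩ <;>
      · rw [← hn']
        simp only [Nat.ModEq] at h9 ⊢
        omega
    · obtain ⟨e, he, hn'⟩ : ∃ e, (e = 1 ∨ e = 2) ∧ n = ℓ₁ ^ e * ℓ₂ ^ 2 := by
        rcases hn' with h | h
        · exact ⟨2, by simp, h⟩
        · exact ⟨1, by simp, by simpa using h⟩
      refine ⟨e, 2, hn', .of_not_isCubeMod hp hq hne he (by simp) (hn' ▸ hn) h1 h2 h ?_ ?_⟩ <;>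
      · rw [← hn']
        simp only [Nat.ModEq] at h9 ⊢
        omega
  have hsum : ¬ IsRationalCubeSum (ℓ₁ ^ e * ℓ₂ ^ f) := not_isRationalCubeSum_of_forall
    fun x y z hz ↦ by push_cast; exact D.cube_add_cube_ne hz
  refine ⟨?_, hsum⟩
  have := subsingleton_point_mordellCurve hn0 hsum
  exact rank_subsingleton' ℤ _
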